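/- **Setting.** Let $A$ be an $n\times n$ complex matrix. Write $A=D-E-F$, where $D$ is the diagonal of $A$ and $E$, $F$ are the negations of its strictly lower and strictly upper triangular parts. Assume that $A$ is a consistently ordered 2-cyclic matrix, that is: * $A$ can be brought by a symmetric permutation of rows and columns to the form $\begin{bmatrix} D_1 & A_{12}\\ A_{21} & D_2\end{bmatrix}$ with $D_1,D_2$ diagonal and nonsingular (so $D$ is nonsingular), and * the eigenvalues, counted with multiplicity, of $\alpha D^{-1}E+\alpha^{-1}D^{-1}F$ do not depend on $\alpha\in\mathbb C\setminus\{0\}$ (this holds automatically if $A$ is itself in the above block form). Let $\mathcal J=D^{-1}(E+F)$ be the Jacobi iteration matrix and $\mathcal L_\omega=(D-\omega E)^{-1}(\omega F+(1-\omega)D)$, $\omega\in\mathbb C$, the SOR iteration matrix. Let $\sigma$ and $\rho$ denote spectrum and spectral radius. Let $\tilde\mu\in\mathbb C$ with $\operatorname{Re}\tilde\mu\ge 0$, and suppose that $$\sigma(\mathcal J)\subseteq[-\tilde\mu,\tilde\mu]:=\{t\tilde\mu: t\in[-1,1]\},\qquad \pm\tilde\mu\in\sigma(\mathcal J).$$ Square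 roots and arguments are principal, with $\operatorname{Arg}\in(-\pi,\pi]$ (and $\operatorname{Arg}(0)=0$ by convention). Put $\delta=|\operatorname{Arg}(\tilde\mu-1)|$. For $R\ge 0$ let $$c_R=\begin{cases}\dfrac{1}{\sqrt2\left(\frac1{\sqrt{2-R}}+\sqrt R\right)}, & 0\le R\le 1,\\[2ex] \dfrac{1}{\sqrt2\left(\frac1{\sqrt R}+\sqrt R\right)}, & R>1,\end{cases}\qquad c_R^*=\frac{c_R}{1+\sqrt{R(2+R)}}.$$ **Theorem.** 1. The parameter $$\omega_{\rm opt}=\frac{2}{1+\sqrt{1-\tilde\mu^2}}$$ is optimal: $\rho(\mathcal L_{\omega_{\rm opt}})\le\rho(\mathcal L_\omega)$ for all $\omega\in\mathbb C$. If $\tilde\mu\notin[1,\infty)$, it is the only optimal parameter. Moreover $\rho(\mathcal L_{\omega_{\rm opt}})=|1-\omega_{\rm opt}|$. 2. The function $R\mapsto c_R^*$ is positive and strictly decreasing on $[0,\infty)$, with $c_0^*=1$. The function $\beta\mapsto\sin\left(\frac\delta2+\beta\right)$ attains a minimum and a maximum on $0\le\beta\le\frac12\arctan|\operatorname{Im}\tilde\mu|$.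 For every minimizer $\beta_m$, every maximizer $\beta_M$ and every $R\ge|\tilde\mu-1|$, $$2\sqrt2\,c_R^*\sin\left(\tfrac\delta2+\beta_m\right)\sqrt{|1-\tilde\mu|}\;\le\;1-\rho(\mathcal L_{\omega_{\rm opt}})\;\le\;2\sqrt2\,\sin\left(\tfrac\delta2+\beta_M\right)\sqrt{|1-\tilde\mu|}.$$ 3. If $\tilde\mu\notin[1,\infty)$, then $\rho(\mathcal L_{\omega_{\rm opt}})<1$. If $\tilde\mu\in[1,\infty)$, then $\rho(\mathcal L_{\omega_{\rm opt}})=1$. -/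

import Mathlib

noncomputable section

/-- The part `D` of the splitting `A = D - E - F`: the diagonal of `A`. -/
def diagPart {n : ℕ} (A : Matrix (Fin n) (Fin n) ℂ) : Matrix (Fin n) (Fin n) ℂ :=
  Matrix.diagonal fun i => A i i

/-- The part `E` of the splitting `A = D - E - F`: the negated strictly lower triangular part. -/
def lowerPart {n : ℕ} (A : Matrix (Fin n) (Fin n) ℂ) : Matrix (Fin n) (Fin n) ℂ :=
  Matrix.of fun i j => if j < i then -A i j else 0

/-- The part `F` of the splitting `A = D - E - F`: the negated strictly upper triangular part. -/
def upperPart {n : ℕ} (A : Matrix (Fin n) (Fin n) ℂ) : Matrix (Fin n) (Fin n) ℂ :=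
  Matrix.of fun i j => if i < j then -A i j else 0

/-- The Jacobi iteration matrix `D⁻¹ (E + F)`. -/
def jacobi {n : ℕ} (A : Matrix (Fin n) (Fin n) ℂ) : Matrix (Fin n) (Fin n) ℂ :=
  (diagPart A)⁻¹ * (lowerPart A + upperPart A)

/-- The SOR iteration matrix `(D - ω E)⁻¹ (ω F + (1 - ω) D)`. -/
def sor {n : ℕ} (A : Matrix (Fin n) (Fin n) ℂ) (ω : ℂ) : Matrix (Fin n) (Fin n) ℂ :=
  (diagPart A - ω • lowerPart A)⁻¹ * (ω • upperPart A + (1 - ω) • diagPart A)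

/-- The spectral radius of a complex matrix: the largest modulus of an eigenvalue.
(The spectrum is finite, so that the supremum that defines `spectralRadius` is finite.) -/
def specRad {n : ℕ} (B : Matrix (Fin n) (Fin n) ℂ) : ℝ :=
  (spectralRadius ℂ B).toReal

/-- `A` can be symmetrically permuted into the block form `[[D₁, A₁₂], [A₂₁, D₂]]` with
`D₁`, `D₂` diagonal and nonsingular. -/
def IsTwoCyclic {n : ℕ} (A : Matrix (Fin n) (Fin n) ℂ) : Prop :=
  ∃ (p q : ℕ) (e : Fin n ≃ Fin p ⊕ Fin q) (d₁ : Fin p → ℂ) (d₂ : Fin q → ℂ)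
    (A₁₂ : Matrix (Fin p) (Fin q) ℂ) (A₂₁ : Matrix (Fin q) (Fin p) ℂ),
    (∀ i, d₁ i ≠ 0) ∧ (∀ i, d₂ i ≠ 0) ∧
      Matrix.reindex e e A =
        Matrix.fromBlocks (Matrix.diagonal d₁) A₁₂ A₂₁ (Matrix.diagonal d₂)

/-- A 2-cyclic matrix `A` is consistently ordered (Varga's definition) if the eigenvalues, counted
with multiplicity, of `α D⁻¹ E + α⁻¹ D⁻¹ F` do not depend on `α ≠ 0`. In particular they are those
of the Jacobi matrix, which is the case `α = 1`. Every matrix that is already in the block form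
of `IsTwoCyclic`, with the blocks in that order, has this property. -/
def IsConsistentlyOrderedTwoCyclic {n : ℕ} (A : Matrix (Fin n) (Fin n) ℂ) : Prop :=
  IsTwoCyclic A ∧ ∀ α : ℂ, α ≠ 0 →
    (α • ((diagPart A)⁻¹ * lowerPart A) + α⁻¹ • ((diagPart A)⁻¹ * upperPart A)).charpoly =
      (jacobi A).charpoly

/-- `ω` is an optimal relaxation parameter: it minimizes the spectral radius of the SOR
iteration matrix over all complex relaxation parameters. -/
def IsOptimalRelaxation {n : ℕ} (A : Matrix (Fin n) (Fin n) ℂ) (ω : ℂ) : Prop :=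
  ∀ ω' : ℂ, specRad (sor A ω) ≤ specRad (sor A ω')

/-- The segment `[-μ, μ] = {t μ : t ∈ [-1, 1]}` in the complex plane. -/
def symSegment (μ : ℂ) : Set ℂ :=
  (fun t : ℝ => (t : ℂ) * μ) '' Set.Icc (-1) 1

/-- The slit `[1, ∞)` in the complex plane. -/
def slit : Set ℂ :=
  (fun x : ℝ => (x : ℂ)) '' Set.Ici 1

/-- The number `2 / (1 + √(1 - μ²))`, with the principal square root. -/
def omegaOpt (μ : ℂ) : ℂ :=
  2 / (1 + Complex.sqrt (1 - μ ^ 2))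

/-- The constant `c_R`, for `R ≥ 0`. -/
def cConst (R : ℝ) : ℝ :=
  if R ≤ 1 then 1 / (√2 * (1 / √(2 - R) + √R)) else 1 / (√2 * (1 / √R + √R))

/-- The constant `c*_R`, for `R ≥ 0`. -/
def cStar (R : ℝ) : ℝ :=
  cConst R / (1 + √(R * (2 + R)))

end

/-! By Young's relation (`sq_mem_spectrum_sor_iff`), a Jacobi eigenvalue `μ` gives two roots `z₁,
z₂` of `z² - ωμz + ω - 1` whose squares are SOR eigenvalues. Eliminating `ω = 1 + z₁z₂` leaves `z₁ +
z₂ = μ(1 + z₁z₂)`: a Möbius involution exchanges the roots. Optimizing `ω` means fitting such a pair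
into the smallest disc. Off the slit this forces both roots to the fixed point `z₀ = optRoot μ`
inside the unit disc (`eq_of_norm_le_of_add_mul_eq`); on the slit no pair fits in the open unit
disc. Conversely, at `ω = 1 + z₀²` the segment hypothesis puts every root on the circle `|z| = |z₀|`
(`norm_eq_of_sq_add_sq_eq`), so the optimal radius is `|z₀|²`.

For the bounds, with `s = √(1 - μ²)`, `1 - |z₀|²` is `Re s` times an explicit factor
(`one_sub_norm_optRoot_sq`), and `re_sqrt_one_sub_sq` writes `Re s` through a sine whose angle lies
in the admissible range of `β`. Norm estimates of the other factors give the constants. -/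

/-! ### Determinants and Young's relation -/

theorem IsTwoCyclic.diag_ne_zero {n : ℕ} {A : Matrix (Fin n) (Fin n) ℂ} (hA : IsTwoCyclic A)
    (i : Fin n) : A i i ≠ 0 := by
  obtain ⟨p, q, e, d₁, d₂, A₁₂, A₂₁, h₁, h₂, h⟩ := hA
  have hi := congrFun (congrFun h (e i)) (e i)
  rw [Matrix.reindex_apply, Matrix.submatrix_apply, Equiv.symm_apply_apply] at hi
  rw [hi]
  rcases e i with a | b
  · simpa using h₁ a
  · simpa using h₂ b

theorem mem_spectrum_iff_det_eq_zero {n : ℕ} (B : Matrix (Fin n) (Fin n) ℂ) (c : ℂ) :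
    c ∈ spectrum ℂ B ↔ (c • (1 : Matrix (Fin n) (Fin n) ℂ) - B).det = 0 := by
  rw [spectrum.mem_iff, Matrix.isUnit_iff_isUnit_det, isUnit_iff_ne_zero, not_not,
    Algebra.algebraMap_eq_smul_one]

theorem eval_charpoly_eq_det {n : ℕ} (B : Matrix (Fin n) (Fin n) ℂ) (c : ℂ) :
    B.charpoly.eval c = (c • (1 : Matrix (Fin n) (Fin n) ℂ) - B).det := by
  rw [Matrix.eval_charpoly, Matrix.smul_one_eq_diagonal, Matrix.scalar_apply]

theorem det_diagPart_sub_smul_lowerPart {n : ℕ} (A : Matrix (Fin n) (Fin n) ℂ) (a c : ℂ) :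
    (a • diagPart A - c • lowerPart A).det = ∏ i, a * A i i := by
  rw [Matrix.det_of_isLowerTriangular]
  · simp [diagPart, lowerPart]
  · intro i j hij
    have hij' : i < j := hij
    simp [diagPart, lowerPart, hij'.ne, hij'.le.not_gt]

theorem det_diagPart_sub_smul_upperPart {n : ℕ} (A : Matrix (Fin n) (Fin n) ℂ) (a c : ℂ) :
    (a • diagPart A - c • upperPart A).det = ∏ i, a * A i i := by
  rw [Matrix.det_of_isUpperTriangular]
  · simp [diagPart, upperPart]
  · intro i j hij
    have hij' : j < i := hij
    simp [diagPart, upperPart, hij'.ne', hij'.le.not_gt]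

theorem isUnit_det_diagPart {n : ℕ} {A : Matrix (Fin n) (Fin n) ℂ} (hA : ∀ i, A i i ≠ 0) :
    IsUnit (diagPart A).det := by
  rw [isUnit_iff_ne_zero, diagPart, Matrix.det_diagonal]
  exact Finset.prod_ne_zero_iff.2 fun i _ => hA i

theorem mem_spectrum_sor_iff_det {n : ℕ} {A : Matrix (Fin n) (Fin n) ℂ} (hA : ∀ i, A i i ≠ 0)
    (ω c : ℂ) : c ∈ spectrum ℂ (sor A ω) ↔
      ((c + ω - 1) • diagPart A - (c * ω) • lowerPart A - ω • upperPart A).det = 0 := by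
  have hM : IsUnit (diagPart A - ω • lowerPart A).det := by
    have h := det_diagPart_sub_smul_lowerPart A 1 ω
    rw [one_smul] at h
    rw [h, isUnit_iff_ne_zero]
    exact Finset.prod_ne_zero_iff.2 fun i _ => by simpa using hA i
  have hfac : (c + ω - 1) • diagPart A - (c * ω) • lowerPart A - ω • upperPart A =
      (diagPart A - ω • lowerPart A) * (c • (1 : Matrix (Fin n) (Fin n) ℂ) - sor A ω) := by
    rw [mul_sub, sor, Matrix.mul_nonsing_inv_cancel_left _ _ hM, mul_smul_comm, mul_one]
    module
  rw [mem_spectrum_iff_det_eq_zero, hfac, Matrix.det_mul, mul_eq_zero,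
    or_iff_right hM.ne_zero]

/-- Young's relation between the eigenvalues of the SOR matrix and of the Jacobi matrix, written
with a square root `z` of the SOR eigenvalue. -/
theorem sq_mem_spectrum_sor_iff {n : ℕ} {A : Matrix (Fin n) (Fin n) ℂ}
    (hA : IsConsistentlyOrderedTwoCyclic A) (hne : (spectrum ℂ (jacobi A)).Nonempty) (ω z : ℂ) :
    z ^ 2 ∈ spectrum ℂ (sor A ω) ↔
      ∃ ν ∈ spectrum ℂ (jacobi A), z ^ 2 + ω - 1 = ω * ν * z := by
  have hd : ∀ i, A i i ≠ 0 := hA.1.diag_ne_zero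
  have hD := isUnit_det_diagPart hd
  have hn : 0 < n := by
    rcases Nat.eq_zero_or_pos n with rfl | h
    · obtain ⟨ν, hν⟩ := hne
      rw [mem_spectrum_iff_det_eq_zero] at hν
      simp at hν
    · exact h
  have hprod : ∀ a : ℂ, ∏ i, a * A i i = 0 ↔ a = 0 := by
    intro a
    rw [Finset.prod_mul_distrib, mul_eq_zero,
      or_iff_left (Finset.prod_ne_zero_iff.2 fun i _ => hd i)]
    simp [hn.ne']
  rw [mem_spectrum_sor_iff_det hd]
  -- If `ωz = 0`, the matrix is triangular and `ν` drops out of the relation. Otherwise dividing by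
  -- `ωz` exposes the consistent-ordering pencil at `α = z`.
  by_cases h : ω * z = 0
  · have hl : ((z ^ 2 + ω - 1) • diagPart A - (z ^ 2 * ω) • lowerPart A - ω • upperPart A).det =
        ∏ i, (z ^ 2 + ω - 1) * A i i := by
      have h0 : z ^ 2 * ω = 0 := by linear_combination z * h
      rw [h0, zero_smul, sub_zero, det_diagPart_sub_smul_upperPart]
    rw [hl, hprod]
    have h1 : ∀ ν, ω * ν * z = 0 := fun ν => by linear_combination ν * h
    simp only [h1]
    exact ⟨fun h2 => ⟨hne.some, hne.some_mem, h2⟩, fun ⟨_, _, h2⟩ => h2⟩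
  · have hz : z ≠ 0 := right_ne_zero_of_mul h
    have hω : ω ≠ 0 := left_ne_zero_of_mul h
    set c := (z ^ 2 + ω - 1) / (ω * z) with hc
    have hcz : (ω * z) * c = z ^ 2 + ω - 1 := by rw [hc]; field_simp
    set B := z • ((diagPart A)⁻¹ * lowerPart A) + z⁻¹ • ((diagPart A)⁻¹ * upperPart A) with hB
    have hfac : (z ^ 2 + ω - 1) • diagPart A - (z ^ 2 * ω) • lowerPart A - ω • upperPart A =
        diagPart A * ((ω * z) • (c • (1 : Matrix (Fin n) (Fin n) ℂ) - B)) := by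
      rw [hB, mul_smul_comm, mul_sub, mul_add, mul_smul_comm, mul_smul_comm, mul_smul_comm,
        Matrix.mul_nonsing_inv_cancel_left _ _ hD, Matrix.mul_nonsing_inv_cancel_left _ _ hD,
        mul_one, ← hcz, smul_sub, smul_add, smul_smul, smul_smul, smul_smul,
        mul_inv_cancel_right₀ hz, sub_sub]
      congr 3
      ring
    rw [hfac, Matrix.det_mul, Matrix.det_smul, mul_eq_zero, or_iff_right hD.ne_zero, mul_eq_zero,
      or_iff_right (pow_ne_zero _ h), ← eval_charpoly_eq_det, hA.2 z hz, eval_charpoly_eq_det,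
      ← mem_spectrum_iff_det_eq_zero]
    constructor
    · exact fun hm => ⟨c, hm, by linear_combination -hcz⟩
    · rintro ⟨ν, hν, h2⟩
      have : c = ν := by
        rw [hc, h2]; field_simp
      rwa [this]

/-! ### Spectral radius and principal square root -/

theorem specRad_le {n : ℕ} {B : Matrix (Fin n) (Fin n) ℂ} {r : ℝ} (hr : 0 ≤ r)
    (h : ∀ c ∈ spectrum ℂ B, ‖c‖ ≤ r) : specRad B ≤ r := by
  refine ENNReal.toReal_le_of_le_ofReal hr (iSup₂_le fun c hc => ?_)
  rw [← enorm_eq_nnnorm, ← ofReal_norm]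
  exact ENNReal.ofReal_le_ofReal (h c hc)

theorem norm_le_specRad {n : ℕ} {B : Matrix (Fin n) (Fin n) ℂ} {c : ℂ}
    (hc : c ∈ spectrum ℂ B) : ‖c‖ ≤ specRad B := by
  obtain ⟨r, hr⟩ := (Matrix.finite_spectrum B).isBounded.exists_norm_le
  have hfin : spectralRadius ℂ B ≠ ⊤ := by
    refine ne_top_of_le_ne_top (ENNReal.ofReal_ne_top (r := r)) (iSup₂_le fun c hc => ?_)
    rw [← enorm_eq_nnnorm, ← ofReal_norm]
    exact ENNReal.ofReal_le_ofReal (hr c hc)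
  rw [← toReal_enorm]
  exact ENNReal.toReal_mono hfin (le_iSup₂ (f := fun k (_ : k ∈ spectrum ℂ B) => (‖k‖₊ : ENNReal)) c hc)

theorem Complex.sqrt_mul_self_eq (a : ℂ) : a.sqrt * a.sqrt = a := by
  rw [Complex.sqrt, ← sq]
  exact_mod_cast Complex.cpow_nat_inv_pow a two_ne_zero

theorem Complex.re_sqrt_eq (a : ℂ) : a.sqrt.re = √((‖a‖ + a.re) / 2) :=
  Complex.cpow_inv_two_re a

theorem Complex.re_sqrt_nonneg (a : ℂ) : 0 ≤ a.sqrt.re := by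
  rw [Complex.re_sqrt_eq]; positivity

/-! ### The constants -/

theorem cConst_pos (R : ℝ) : 0 < cConst R := by
  unfold cConst
  split_ifs with h
  · have : 0 < √(2 - R) := Real.sqrt_pos.2 (by linarith)
    positivity
  · have : 0 < √R := Real.sqrt_pos.2 (by linarith)
    positivity

theorem cStar_pos (R : ℝ) : 0 < cStar R := by
  have := cConst_pos R
  unfold cStar
  positivity

theorem cStar_zero : cStar 0 = 1 := by
  simp [cStar, cConst]

theorem cConst_antitoneOn : AntitoneOn cConst (Set.Ici 0) := by
  have key₁ : AntitoneOn cConst (Set.Icc 0 1) := by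
    intro a ha b hb hab
    simp only [cConst, if_pos ha.2, if_pos hb.2]
    have : 0 < √(2 - b) := Real.sqrt_pos.2 (by linarith [hb.2])
    have : 0 < √(2 - a) := Real.sqrt_pos.2 (by linarith [ha.2])
    gcongr
  have h1 : cConst 1 = 1 / (√2 * (1 / √1 + √1)) := by
    norm_num [cConst]
  -- The two formulas agree at `R = 1`, so both monotone pieces can include that point.
  have hI : ∀ R : ℝ, 1 ≤ R → cConst R = 1 / (√2 * (1 / √R + √R)) := by
    intro R hR
    rcases hR.eq_or_lt with rfl | h
    · exact h1
    · simp only [cConst, if_neg h.not_ge]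
  have key₂ : AntitoneOn cConst (Set.Ici 1) := by
    intro a ha b hb hab
    rw [hI a ha, hI b hb]
    have hsa : 1 ≤ √a := Real.one_le_sqrt.2 ha
    have hsab : √a ≤ √b := Real.sqrt_le_sqrt hab
    have ha0 : √a ≠ 0 := by positivity
    have hb0 : √b ≠ 0 := (by linarith : 0 < √b).ne'
    have : 1 / √a + √a ≤ 1 / √b + √b := by
      have e : 1 / √b + √b - (1 / √a + √a) = (√b - √a) * (√a * √b - 1) / (√a * √b) := by
        field_simp
        ring
      have : 0 ≤ (√b - √a) * (√a * √b - 1) / (√a * √b) := by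
        apply div_nonneg _ (by positivity)
        apply mul_nonneg (by linarith)
        nlinarith
      linarith
    gcongr
  intro a ha b hb hab
  have ha : 0 ≤ a := ha
  rcases le_total b 1 with h | h
  · exact key₁ ⟨ha, hab.trans h⟩ ⟨ha.trans hab, h⟩ hab
  · rcases le_total a 1 with h' | h'
    · exact (key₂ (Set.mem_Ici.2 le_rfl) h h).trans (key₁ ⟨ha, h'⟩ ⟨zero_le_one, le_rfl⟩ h')
    · exact key₂ h' h hab

theorem cStar_strictAntiOn : StrictAntiOn cStar (Set.Ici 0) := by
  intro a ha b hb hab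
  have ha : 0 ≤ a := ha
  unfold cStar
  have h1 : cConst b ≤ cConst a := cConst_antitoneOn ha hb hab.le
  have h2 : √(a * (2 + a)) < √(b * (2 + b)) := Real.sqrt_lt_sqrt (by positivity) (by nlinarith)
  have h3 := cConst_pos a
  calc cConst b / (1 + √(b * (2 + b))) ≤ cConst a / (1 + √(b * (2 + b))) := by gcongr
    _ < cConst a / (1 + √(a * (2 + a))) := by gcongr

/-- The geometric estimate behind `cConst`: here `a = |1 + μ|` and `R = |1 - μ|`. -/
theorem sqrt_add_div_sqrt_mul_cConst_le {a R : ℝ} (hR : 0 ≤ R) (haR : R ≤ a) (ha₁ : 1 ≤ a)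
    (ha₂ : 2 - R ≤ a) (ha₃ : a ≤ 2 + R) : (a + R) * cConst R ≤ √2 * √a := by
  have hsa : 0 < √a := Real.sqrt_pos.2 (by linarith)
  have haa : √a * √a = a := Real.mul_self_sqrt (by linarith)
  have key : √a + R / √a ≤ √2 / cConst R := by
    unfold cConst
    have h22 : √2 * √2 = 2 := Real.mul_self_sqrt (by norm_num)
    -- The term `R / √a` is largest at the smallest admissible `a`, which is `2 - R` for `R ≤ 1` and
    -- `R` beyond; `√a` is bounded using `a ≤ 2 + R`.
    split_ifs with h
    · have h2R : 0 < √(2 - R) := Real.sqrt_pos.2 (by linarith)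
      have hm : √(2 - R) * √(2 - R) = 2 - R := Real.mul_self_sqrt (by linarith)
      have e : √2 / (1 / (√2 * (1 / √(2 - R) + √R))) = R / √(2 - R) + √(2 - R) + 2 * √R := by
        rw [div_div_eq_mul_div, div_one, ← mul_assoc, h22]
        field_simp
        nlinarith
      have h1 : √a ≤ √(2 - R) + 2 * √R := by
        rw [Real.sqrt_le_left (by positivity)]
        nlinarith [Real.mul_self_sqrt hR, mul_nonneg h2R.le (Real.sqrt_nonneg R)]
      have h2 : R / √a ≤ R / √(2 - R) := by gcongr
      linarith
    · have h0 : 0 < √R := Real.sqrt_pos.2 (by linarith)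
      have hm : √R * √R = R := Real.mul_self_sqrt hR
      have e : √2 / (1 / (√2 * (1 / √R + √R))) = 2 / √R + √R + √R := by
        rw [div_div_eq_mul_div, div_one, ← mul_assoc, h22]
        ring
      have h1 : √a ≤ 2 / √R + √R := by
        rw [Real.sqrt_le_left (by positivity)]
        have : 2 / √R * √R = 2 := by field_simp
        nlinarith [sq_nonneg (2 / √R)]
      have h2 : R / √a ≤ √R := by
        rw [div_le_iff₀ hsa]
        nlinarith [Real.sqrt_le_sqrt haR]
      linarith
  have hc := cConst_pos R
  rw [le_div_iff₀ hc] at key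
  have : (a + R) * cConst R = √a * ((√a + R / √a) * cConst R) := by
    field_simp
    nlinarith
  rw [this]
  nlinarith

/-! ### Arguments and the real part of the root -/

theorem Complex.norm_mul_cos_abs_arg (z : ℂ) : ‖z‖ * Real.cos |z.arg| = z.re := by
  rw [Real.cos_abs, Complex.norm_mul_cos_arg]

theorem Complex.norm_mul_sin_abs_arg (z : ℂ) : ‖z‖ * Real.sin |z.arg| = |z.im| := by
  rw [← Complex.norm_mul_sin_arg, abs_mul, abs_of_nonneg (norm_nonneg z),
    Real.abs_sin_eq_sin_abs_of_abs_le_pi (Complex.abs_arg_le_pi z)]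

/-- The tangent of the angle is `|Im μ| / (1 + Re μ)`, and the denominator is at least 1. -/
theorem Complex.abs_arg_one_add_le {μ : ℂ} (hre : 0 ≤ μ.re) :
    |(1 + μ).arg| ≤ Real.arctan |μ.im| := by
  have hp : 0 < (1 + μ).re := by simp; linarith
  have h1 : |(1 + μ).arg| < Real.pi / 2 := Complex.abs_arg_lt_pi_div_two_iff.2 (Or.inl hp)
  rw [← Real.arctan_tan (by linarith [abs_nonneg (1 + μ).arg, Real.pi_pos]) h1]
  apply Real.arctan_strictMono.monotone
  have ht : Real.tan |(1 + μ).arg| = |(1 + μ).im| / (1 + μ).re := by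
    rw [Real.tan_eq_sin_div_cos, ← Complex.norm_mul_sin_abs_arg, ← Complex.norm_mul_cos_abs_arg,
      mul_div_mul_left]
    rw [norm_ne_zero_iff]
    rintro h
    simp [h] at hp
  rw [ht]
  simp only [Complex.add_im, Complex.one_im, zero_add, Complex.add_re, Complex.one_re]
  exact div_le_self (abs_nonneg _) (by linarith)

/-- The numbers `μ - 1` and `1 + μ` share their imaginary part, so the absolute arguments add up in
the product `μ² - 1`. The half-angle formula then yields the sine. -/
theorem re_sqrt_one_sub_sq {μ : ℂ} (hre : 0 ≤ μ.re) :
    (Complex.sqrt (1 - μ ^ 2)).re = √‖1 - μ‖ * √‖1 + μ‖ *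
      Real.sin (|(μ - 1).arg| / 2 + |(1 + μ).arg| / 2) := by
  set δ := |(μ - 1).arg| with hδ
  set φ := |(1 + μ).arg| with hφ
  have hφ₁ : φ ≤ Real.pi / 2 :=
    Complex.abs_arg_le_pi_div_two_iff.2 (by simp; linarith)
  have hδ₁ : δ ≤ Real.pi := Complex.abs_arg_le_pi _
  have hs : 0 ≤ Real.sin (δ / 2 + φ / 2) :=
    Real.sin_nonneg_of_nonneg_of_le_pi (by positivity) (by linarith [Real.pi_pos])
  have h1 := Complex.norm_mul_cos_abs_arg (μ - 1)
  have h2 := Complex.norm_mul_cos_abs_arg (1 + μ)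
  have h3 := Complex.norm_mul_sin_abs_arg (μ - 1)
  have h4 := Complex.norm_mul_sin_abs_arg (1 + μ)
  rw [← hδ, norm_sub_rev] at h1 h3
  rw [← hφ] at h2 h4
  have hn : ‖1 - μ ^ 2‖ = ‖1 - μ‖ * ‖1 + μ‖ := by
    rw [← norm_mul]; congr 1; ring
  have hc : ‖1 - μ‖ * ‖1 + μ‖ * Real.cos (2 * (δ / 2 + φ / 2)) = - (1 - μ ^ 2).re := by
    have e : 2 * (δ / 2 + φ / 2) = δ + φ := by ring
    have : ‖1 - μ‖ * ‖1 + μ‖ * Real.cos (δ + φ) = (‖1 - μ‖ * Real.cos δ) * (‖1 + μ‖ * Real.cos φ)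
        - (‖1 - μ‖ * Real.sin δ) * (‖1 + μ‖ * Real.sin φ) := by
      rw [Real.cos_add]; ring
    rw [e, this, h1, h2, h3, h4]
    simp [sq]
    ring
  rw [Real.cos_two_mul, Real.cos_sq'] at hc
  have e1 := Real.sq_sqrt (norm_nonneg (1 - μ))
  have e2 := Real.sq_sqrt (norm_nonneg (1 + μ))
  have e : (‖1 - μ ^ 2‖ + (1 - μ ^ 2).re) / 2 =
      (√‖1 - μ‖ * √‖1 + μ‖ * Real.sin (δ / 2 + φ / 2)) ^ 2 := by
    rw [mul_pow, mul_pow, e1, e2, hn]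
    linarith
  rw [Complex.re_sqrt_eq, e, Real.sqrt_sq (by positivity)]

/-! ### Pairs of roots in a disc -/

theorem exists_add_eq_mul_eq (b c : ℂ) : ∃ z₁ z₂ : ℂ, z₁ + z₂ = b ∧ z₁ * z₂ = c := by
  obtain ⟨d, hd⟩ := IsAlgClosed.exists_eq_mul_self (b ^ 2 - 4 * c)
  exact ⟨(b + d) / 2, (b - d) / 2, by ring, by linear_combination hd / 4⟩

/-- If `z₁` and `z₂` are exchanged by the Möbius involution with fixed points `z₀` and `z₀⁻¹`, and
lie in the disc of radius `|z₀| < 1`, then both are equal to `z₀`. -/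
theorem eq_of_norm_le_of_add_mul_eq {z₀ z₁ z₂ : ℂ} (h₀ : ‖z₀‖ < 1) (h₁ : ‖z₁‖ ≤ ‖z₀‖)
    (h₂ : ‖z₂‖ ≤ ‖z₀‖) (h : (z₁ + z₂) * (1 + z₀ ^ 2) = 2 * z₀ * (1 + z₁ * z₂)) :
    z₁ = z₀ ∧ z₂ = z₀ := by
  have hne : ∀ z : ℂ, ‖z‖ ≤ ‖z₀‖ → 1 - z₀ * z ≠ 0 := by
    intro z hz h0
    have h1 : ‖z₀ * z‖ = 1 := by rw [← sub_eq_zero.1 h0, norm_one]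
    rw [norm_mul] at h1
    nlinarith [norm_nonneg z₀, norm_nonneg z]
  have hu₁ := hne z₁ h₁
  have hu₂ := hne z₂ h₂
  -- This coordinate sends `z₀` to `0` and turns the involution into `w ↦ -w`.
  set w := (z₁ - z₀) / (1 - z₀ * z₁) with hw
  have hw₁ : w * (1 - z₀ * z₁) = z₁ - z₀ := div_mul_cancel₀ _ hu₁
  have hw₂ : -w * (1 - z₀ * z₂) = z₂ - z₀ := by
    apply mul_right_cancel₀ hu₁
    linear_combination (-(1 - z₀ * z₂)) * hw₁ - h
  have e₁ : z₀ + w = z₁ * (1 + z₀ * w) := by linear_combination hw₁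
  have e₂ : z₀ - w = z₂ * (1 - z₀ * w) := by linear_combination hw₂
  have n₁ : ‖z₀ + w‖ ≤ ‖z₀‖ * ‖1 + z₀ * w‖ := by
    rw [e₁, norm_mul]; gcongr
  have n₂ : ‖z₀ - w‖ ≤ ‖z₀‖ * ‖1 - z₀ * w‖ := by
    rw [e₂, norm_mul]; gcongr
  -- Adding the squares of `n₁` and `n₂` cancels the cross terms and leaves `|w|²(1 - |z₀|⁴) ≤ 0`.
  have p₁ := parallelogram_law_with_norm ℝ z₀ w
  have p₂ := parallelogram_law_with_norm ℝ (1 : ℂ) (z₀ * w)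
  rw [norm_mul, norm_one] at p₂
  have m₁ := mul_self_le_mul_self (norm_nonneg _) n₁
  have m₂ := mul_self_le_mul_self (norm_nonneg _) n₂
  have hsum : ‖w‖ ^ 2 * (1 - ‖z₀‖ ^ 4) ≤ 0 := by
    have : ‖z₀‖ * ‖1 + z₀ * w‖ * (‖z₀‖ * ‖1 + z₀ * w‖) + ‖z₀‖ * ‖1 - z₀ * w‖ * (‖z₀‖ * ‖1 - z₀ * w‖)
        = ‖z₀‖ ^ 2 * (2 * (1 ^ 2 + (‖z₀‖ * ‖w‖) ^ 2)) := by
      rw [← p₂]; ring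
    nlinarith
  have h4 : ‖z₀‖ ^ 4 < 1 := pow_lt_one₀ (norm_nonneg _) h₀ (by norm_num)
  have hw0 : w = 0 := by
    by_contra hne
    have : 0 < ‖w‖ := norm_pos_iff.2 hne
    have : 0 < ‖w‖ ^ 2 * (1 - ‖z₀‖ ^ 4) := mul_pos (by positivity) (by linarith)
    linarith
  rw [hw0] at hw₁ hw₂
  exact ⟨by linear_combination -hw₁, by linear_combination -hw₂⟩

theorem mem_slit_iff {μ : ℂ} : μ ∈ slit ↔ 1 ≤ μ.re ∧ μ.im = 0 := by
  constructor
  · rintro ⟨x, hx, rfl⟩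
    exact ⟨by simpa using hx, by simp⟩
  · rintro ⟨h1, h2⟩
    exact ⟨μ.re, h1, by apply Complex.ext <;> simp [h2]⟩

/-- For a parameter on the slit, the two numbers cannot both lie in the open unit disc. -/
theorem one_le_norm_or_of_mem_slit {μ z₁ z₂ : ℂ} (hμ : μ ∈ slit)
    (h : z₁ + z₂ = μ * (1 + z₁ * z₂)) : 1 ≤ ‖z₁‖ ∨ 1 ≤ ‖z₂‖ := by
  by_contra! hlt
  obtain ⟨x, hx, rfl⟩ := hμ
  have hx : 1 ≤ x := hx
  have hre : ∀ z : ℂ, ‖z‖ < 1 → |z.re| < 1 := fun z hz => (Complex.abs_re_le_norm z).trans_lt hz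
  have r₁ := abs_lt.1 (hre _ hlt.1)
  have r₂ := abs_lt.1 (hre _ hlt.2)
  -- Cayley form: `(x - 1)(1 + z₁)/(1 - z₁) = -(1 + x)(1 - z₂)/(1 + z₂)`, where both quotients have
  -- positive real part in the unit disc. Below, conjugates clear the denominators.
  have key : (x - 1 : ℂ) * ((1 + z₁) * (1 + z₂)) = -(1 + x) * ((1 - z₁) * (1 - z₂)) := by
    linear_combination -2 * h
  have hu : (1 - z₁) ≠ 0 := fun h0 => by
    have := congrArg Complex.re h0
    simp at this; linarith
  have hv : (1 + z₂) ≠ 0 := fun h0 => by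
    have := congrArg Complex.re h0
    simp at this; linarith
  have key₂ : ((x - 1 : ℝ) * (Complex.normSq (1 + z₂) : ℝ) : ℂ) * ((1 + z₁) * (starRingEnd ℂ) (1 - z₁))
      = -((1 + x : ℝ) * (Complex.normSq (1 - z₁) : ℝ)) * ((1 - z₂) * (starRingEnd ℂ) (1 + z₂)) := by
    rw [Complex.normSq_eq_conj_mul_self, Complex.normSq_eq_conj_mul_self]
    push_cast
    linear_combination ((starRingEnd ℂ) (1 + z₂) * (starRingEnd ℂ) (1 - z₁)) * key
  have key₃ := congrArg Complex.re key₂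
  rw [← Complex.ofReal_mul, ← Complex.ofReal_mul, ← Complex.ofReal_neg, Complex.re_ofReal_mul,
    Complex.re_ofReal_mul] at key₃
  have q : ∀ z : ℂ, ‖z‖ < 1 → 0 < 1 - z.re * z.re - z.im * z.im := by
    intro z hz
    have : Complex.normSq z < 1 := by
      rw [Complex.normSq_eq_norm_sq]; exact pow_lt_one₀ (norm_nonneg _) hz two_ne_zero
    rw [Complex.normSq_apply] at this
    linarith
  have e₁ : 0 < ((1 + z₁) * (starRingEnd ℂ) (1 - z₁)).re := by
    have := q z₁ hlt.1
    simp
    linarith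
  have e₂ : 0 < ((1 - z₂) * (starRingEnd ℂ) (1 + z₂)).re := by
    have := q z₂ hlt.2
    simp
    linarith
  have p₁ : 0 < Complex.normSq (1 - z₁) := Complex.normSq_pos.2 hu
  have p₂ : 0 < Complex.normSq (1 + z₂) := Complex.normSq_pos.2 hv
  have l₁ : 0 ≤ (x - 1) * Complex.normSq (1 + z₂) * ((1 + z₁) * (starRingEnd ℂ) (1 - z₁)).re :=
    mul_nonneg (mul_nonneg (by linarith) p₂.le) e₁.le
  have l₂ : 0 < (1 + x) * Complex.normSq (1 - z₁) * ((1 - z₂) * (starRingEnd ℂ) (1 + z₂)).re :=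
    mul_pos (mul_pos (by linarith) p₁) e₂
  linarith

/-! ### The optimal root -/

/-- The double root of `z² - ω μ z + ω - 1` for `ω = omegaOpt μ`. -/
noncomputable def optRoot (μ : ℂ) : ℂ :=
  μ / (1 + Complex.sqrt (1 - μ ^ 2))

theorem one_add_sqrt_ne_zero (a : ℂ) : 1 + a.sqrt ≠ 0 := fun h => by
  have h1 := congrArg Complex.re h
  have := Complex.re_sqrt_nonneg a
  simp at h1
  linarith

theorem optRoot_sq (μ : ℂ) : optRoot μ ^ 2 =
    (1 - Complex.sqrt (1 - μ ^ 2)) / (1 + Complex.sqrt (1 - μ ^ 2)) := by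
  have h := one_add_sqrt_ne_zero (1 - μ ^ 2)
  have h2 := Complex.sqrt_mul_self_eq (1 - μ ^ 2)
  rw [optRoot, div_pow, div_eq_div_iff (pow_ne_zero _ h) h]
  linear_combination (1 + Complex.sqrt (1 - μ ^ 2)) * h2

theorem omegaOpt_eq (μ : ℂ) : omegaOpt μ = 1 + optRoot μ ^ 2 := by
  have h := one_add_sqrt_ne_zero (1 - μ ^ 2)
  rw [optRoot_sq, omegaOpt]
  field_simp
  ring

theorem mul_one_add_optRoot_sq (μ : ℂ) : μ * (1 + optRoot μ ^ 2) = 2 * optRoot μ := by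
  rw [← omegaOpt_eq, omegaOpt, optRoot]
  ring

theorem norm_one_sub_omegaOpt (μ : ℂ) : ‖1 - omegaOpt μ‖ = ‖optRoot μ‖ ^ 2 := by
  rw [omegaOpt_eq, ← norm_pow, ← norm_neg]
  congr 1
  ring

theorem norm_one_add_sq (s : ℂ) : ‖1 + s‖ ^ 2 = 1 + 2 * s.re + ‖s‖ ^ 2 := by
  rw [← Complex.normSq_eq_norm_sq, ← Complex.normSq_eq_norm_sq, Complex.normSq_apply,
    Complex.normSq_apply]
  simp
  ring

theorem norm_one_sub_sq (s : ℂ) : ‖1 - s‖ ^ 2 = 1 - 2 * s.re + ‖s‖ ^ 2 := by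
  have := norm_one_add_sq (-s)
  rw [← sub_eq_add_neg, Complex.neg_re, norm_neg] at this
  rw [this]; ring

theorem norm_optRoot_sq (μ : ℂ) : ‖optRoot μ‖ ^ 2 =
    ‖1 - Complex.sqrt (1 - μ ^ 2)‖ / ‖1 + Complex.sqrt (1 - μ ^ 2)‖ := by
  rw [← norm_pow, optRoot_sq, norm_div]

/-- A principal root has zero real part only over `(-∞, 0]`, and `1 - μ² ≤ 0` with `Re μ ≥ 0` forces
`μ` onto the slit. -/
theorem re_sqrt_pos_of_notMem_slit {μ : ℂ} (hre : 0 ≤ μ.re) (hμ : μ ∉ slit) :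
    0 < (Complex.sqrt (1 - μ ^ 2)).re := by
  rw [Complex.re_sqrt_eq, Real.sqrt_pos]
  have h1 := neg_le_of_abs_le (Complex.abs_re_le_norm (1 - μ ^ 2))
  by_contra hle
  have h2 : ‖1 - μ ^ 2‖ = -(1 - μ ^ 2).re := by linarith
  have h3 : (1 - μ ^ 2).im = 0 := by
    have := Complex.sq_norm (1 - μ ^ 2)
    rw [h2, Complex.normSq_apply] at this
    nlinarith
  have h4 : (1 - μ ^ 2).re ≤ 0 := by linarith [norm_nonneg (1 - μ ^ 2)]
  simp [sq] at h3 h4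
  have h5 : μ.re * μ.im = 0 := by linarith
  apply hμ
  rw [mem_slit_iff]
  rcases mul_eq_zero.1 h5 with h | h
  · rw [h] at h4; nlinarith
  · exact ⟨by rw [h] at h4; nlinarith, h⟩

theorem norm_optRoot_lt_one {μ : ℂ} (hre : 0 ≤ μ.re) (hμ : μ ∉ slit) : ‖optRoot μ‖ < 1 := by
  rw [← sq_lt_one_iff₀ (norm_nonneg _), norm_optRoot_sq,
    div_lt_one (norm_pos_iff.2 (one_add_sqrt_ne_zero _)),
    ← sq_lt_sq₀ (norm_nonneg _) (norm_nonneg _), norm_one_add_sq, norm_one_sub_sq]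
  linarith [re_sqrt_pos_of_notMem_slit hre hμ]

theorem re_sqrt_eq_zero_of_mem_slit {μ : ℂ} (hμ : μ ∈ slit) :
    (Complex.sqrt (1 - μ ^ 2)).re = 0 := by
  obtain ⟨x, hx, rfl⟩ := hμ
  have hx : 1 ≤ x := hx
  have e : (1 - (x : ℂ) ^ 2) = ((1 - x ^ 2 : ℝ) : ℂ) := by push_cast; ring
  rw [e, Complex.re_sqrt_ofReal]
  exact Real.sqrt_eq_zero_of_nonpos (by nlinarith)

theorem norm_optRoot_eq_one {μ : ℂ} (hμ : μ ∈ slit) : ‖optRoot μ‖ = 1 := by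
  rw [← sq_eq_sq₀ (norm_nonneg _) zero_le_one, one_pow, norm_optRoot_sq,
    div_eq_one_iff_eq (norm_pos_iff.2 (one_add_sqrt_ne_zero _)).ne',
    ← sq_eq_sq₀ (norm_nonneg _) (norm_nonneg _), norm_one_add_sq, norm_one_sub_sq,
    re_sqrt_eq_zero_of_mem_slit hμ]
  ring

/-- Writing `t = cos θ`, the roots are `z = e^{±iθ} z₀`. -/
theorem norm_eq_of_sq_add_sq_eq {z₀ z : ℂ} {t : ℝ} (ht : t ∈ Set.Icc (-1 : ℝ) 1)
    (h : z ^ 2 + z₀ ^ 2 = 2 * t * z₀ * z) : ‖z‖ = ‖z₀‖ := by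
  have hr : √(1 - t ^ 2) ^ 2 = 1 - t ^ 2 := Real.sq_sqrt (by nlinarith [ht.1, ht.2])
  set r := √(1 - t ^ 2)
  have hrC : (r : ℂ) ^ 2 = 1 - t ^ 2 := by exact_mod_cast hr
  have hfac : (z - (t + r * Complex.I) * z₀) * (z - (t - r * Complex.I) * z₀) = 0 := by
    linear_combination h + z₀ ^ 2 * hrC - (r : ℂ) ^ 2 * z₀ ^ 2 * Complex.I_sq
  have hn : ∀ r' : ℝ, r' ^ 2 = 1 - t ^ 2 → ‖(t + r' * Complex.I : ℂ)‖ = 1 := by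
    intro r' h'
    rw [Complex.norm_add_mul_I, h']
    simp
  rcases mul_eq_zero.1 hfac with h1 | h1
  · rw [sub_eq_zero.1 h1, norm_mul, hn r hr, one_mul]
  · have := hn (-r) (by rw [neg_sq, hr])
    rw [Complex.ofReal_neg, neg_mul, ← sub_eq_add_neg] at this
    rw [sub_eq_zero.1 h1, norm_mul, this, one_mul]

/-! ### Optimality -/

section

variable {n : ℕ} {A : Matrix (Fin n) (Fin n) ℂ} {μ : ℂ}

theorem specRad_sor_omegaOpt_le (hA : IsConsistentlyOrderedTwoCyclic A)
    (hseg : spectrum ℂ (jacobi A) ⊆ symSegment μ) (hpos : μ ∈ spectrum ℂ (jacobi A)) :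
    specRad (sor A (omegaOpt μ)) ≤ ‖optRoot μ‖ ^ 2 := by
  refine specRad_le (by positivity) fun c hc => ?_
  obtain ⟨z, rfl⟩ := IsAlgClosed.exists_eq_mul_self c
  rw [← sq] at hc ⊢
  obtain ⟨ν, hν, h⟩ := (sq_mem_spectrum_sor_iff hA ⟨μ, hpos⟩ _ _).1 hc
  obtain ⟨t, ht, rfl⟩ := hseg hν
  rw [norm_pow]
  refine (congrArg (· ^ 2) (norm_eq_of_sq_add_sq_eq ht ?_)).le
  rw [omegaOpt_eq] at h
  linear_combination h + t * z * mul_one_add_optRoot_sq μ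

/-- Two SOR eigenvalues `z₁²`, `z₂²` that belong to the same Jacobi eigenvalue `μ`. -/
theorem exists_sor_eigenvalue_pair (hA : IsConsistentlyOrderedTwoCyclic A)
    (hpos : μ ∈ spectrum ℂ (jacobi A)) (ω : ℂ) :
    ∃ z₁ z₂ : ℂ, z₁ + z₂ = μ * (1 + z₁ * z₂) ∧ ω = 1 + z₁ * z₂ ∧
      ‖z₁‖ ^ 2 ≤ specRad (sor A ω) ∧ ‖z₂‖ ^ 2 ≤ specRad (sor A ω) := by
  obtain ⟨z₁, z₂, h1, h2⟩ := exists_add_eq_mul_eq (ω * μ) (ω - 1)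
  refine ⟨z₁, z₂, by rw [h1, h2]; ring, by rw [h2]; ring, ?_, ?_⟩
  · rw [← norm_pow]
    refine norm_le_specRad ((sq_mem_spectrum_sor_iff hA ⟨μ, hpos⟩ _ _).2 ⟨μ, hpos, ?_⟩)
    linear_combination z₁ * h1 - h2
  · rw [← norm_pow]
    refine norm_le_specRad ((sq_mem_spectrum_sor_iff hA ⟨μ, hpos⟩ _ _).2 ⟨μ, hpos, ?_⟩)
    linear_combination z₂ * h1 - h2

theorem eq_omegaOpt_of_specRad_le (hA : IsConsistentlyOrderedTwoCyclic A) (hre : 0 ≤ μ.re)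
    (hpos : μ ∈ spectrum ℂ (jacobi A)) (hμ : μ ∉ slit) {ω : ℂ}
    (hω : specRad (sor A ω) ≤ ‖optRoot μ‖ ^ 2) : ω = omegaOpt μ := by
  obtain ⟨z₁, z₂, h, rfl, h₁, h₂⟩ := exists_sor_eigenvalue_pair hA hpos ω
  have hle : ∀ z : ℂ, ‖z‖ ^ 2 ≤ specRad (sor A (1 + z₁ * z₂)) → ‖z‖ ≤ ‖optRoot μ‖ := fun z hz =>
    (sq_le_sq₀ (norm_nonneg _) (norm_nonneg _)).1 (hz.trans hω)
  obtain ⟨e₁, e₂⟩ := eq_of_norm_le_of_add_mul_eq (norm_optRoot_lt_one hre hμ) (hle _ h₁) (hle _ h₂)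
    (by linear_combination (1 + optRoot μ ^ 2) * h + (1 + z₁ * z₂) * mul_one_add_optRoot_sq μ)
  rw [e₁, e₂, omegaOpt_eq]
  ring

theorem norm_optRoot_sq_le_specRad_sor (hA : IsConsistentlyOrderedTwoCyclic A) (hre : 0 ≤ μ.re)
    (hpos : μ ∈ spectrum ℂ (jacobi A)) (ω : ℂ) :
    ‖optRoot μ‖ ^ 2 ≤ specRad (sor A ω) := by
  by_cases hμ : μ ∈ slit
  · rw [norm_optRoot_eq_one hμ, one_pow]
    obtain ⟨z₁, z₂, h, -, h₁, h₂⟩ := exists_sor_eigenvalue_pair hA hpos ω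
    rcases one_le_norm_or_of_mem_slit hμ h with h' | h'
    · exact (one_le_pow₀ h').trans h₁
    · exact (one_le_pow₀ h').trans h₂
  -- A strictly smaller radius would force `ω = omegaOpt μ`, hence `z₁z₂ = z₀²`; then one root has
  -- modulus at least `|z₀|`.
  · by_contra! hlt
    obtain ⟨z₁, z₂, -, hω, h₁, h₂⟩ := exists_sor_eigenvalue_pair hA hpos ω
    have he := eq_omegaOpt_of_specRad_le hA hre hpos hμ hlt.le
    have hz : z₁ * z₂ = optRoot μ ^ 2 := by
      rw [he, omegaOpt_eq] at hω
      linear_combination -hω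
    have hn : ‖z₁‖ * ‖z₂‖ = ‖optRoot μ‖ ^ 2 := by rw [← norm_mul, hz, norm_pow]
    nlinarith [sq_nonneg (‖z₁‖ - ‖z₂‖)]

theorem specRad_sor_omegaOpt (hA : IsConsistentlyOrderedTwoCyclic A) (hre : 0 ≤ μ.re)
    (hseg : spectrum ℂ (jacobi A) ⊆ symSegment μ) (hpos : μ ∈ spectrum ℂ (jacobi A)) :
    specRad (sor A (omegaOpt μ)) = ‖optRoot μ‖ ^ 2 :=
  (specRad_sor_omegaOpt_le hA hseg hpos).antisymm
    (norm_optRoot_sq_le_specRad_sor hA hre hpos _)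

end

/-! ### Two-sided bounds -/

section

variable {μ : ℂ}

/-- `1 - |(1 - s) / (1 + s)|` in terms of `Re s`, for `s = √(1 - μ²)`. -/
theorem one_sub_norm_optRoot_sq (μ : ℂ) :
    1 - ‖optRoot μ‖ ^ 2 = 4 * (Complex.sqrt (1 - μ ^ 2)).re /
      (‖1 + Complex.sqrt (1 - μ ^ 2)‖ * (√2 * √(1 + ‖1 - μ‖ * ‖1 + μ‖ + ‖μ‖ ^ 2))) := by
  have hs := Complex.sqrt_mul_self_eq (1 - μ ^ 2)
  rw [norm_optRoot_sq]
  have h0 := one_add_sqrt_ne_zero (1 - μ ^ 2)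
  set s := Complex.sqrt (1 - μ ^ 2)
  have hp : 0 < ‖1 + s‖ := norm_pos_iff.2 h0
  have hm := norm_nonneg (1 - s)
  have h1 := norm_one_add_sq s
  have h2 := norm_one_sub_sq s
  have h3 : ‖1 + s‖ * ‖1 - s‖ = ‖μ‖ ^ 2 := by
    rw [← norm_mul, ← norm_pow]; congr 1; linear_combination -hs
  have h4 : ‖s‖ ^ 2 = ‖1 - μ‖ * ‖1 + μ‖ := by
    rw [← norm_mul, ← norm_pow]; congr 1; linear_combination hs
  -- With this sum, `|1 + s| - |1 - s| = 4 Re s / (|1 + s| + |1 - s|)`.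
  have h5 : √2 * √(1 + ‖1 - μ‖ * ‖1 + μ‖ + ‖μ‖ ^ 2) = ‖1 + s‖ + ‖1 - s‖ := by
    rw [← Real.sqrt_mul (by norm_num), Real.sqrt_eq_iff_mul_self_eq (by positivity) (by positivity)]
    nlinarith
  have h6 : 0 < ‖1 + s‖ + ‖1 - s‖ := by linarith
  rw [h5]
  field_simp
  linarith

theorem one_sub_norm_optRoot_sq_le {M : ℝ} (hM₀ : 0 ≤ M)
    (hM : (Complex.sqrt (1 - μ ^ 2)).re ≤ √‖1 - μ‖ * √‖1 + μ‖ * M) :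
    1 - ‖optRoot μ‖ ^ 2 ≤ 2 * √2 * M * √‖1 - μ‖ := by
  have h1 : 1 ≤ ‖1 + Complex.sqrt (1 - μ ^ 2)‖ := by
    have h := Complex.re_le_norm (1 + Complex.sqrt (1 - μ ^ 2))
    have := Complex.re_sqrt_nonneg (1 - μ ^ 2)
    simp only [Complex.add_re, Complex.one_re] at h
    linarith
  have h2 : √‖1 + μ‖ ≤ √(1 + ‖1 - μ‖ * ‖1 + μ‖ + ‖μ‖ ^ 2) := by
    apply Real.sqrt_le_sqrt
    have h3 : ‖1 + μ‖ ≤ 1 + ‖μ‖ := (norm_add_le _ _).trans (by rw [norm_one])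
    have h4 : 1 - ‖μ‖ ^ 2 ≤ ‖1 - μ‖ * ‖1 + μ‖ := by
      have e : (1 - μ) * (1 + μ) = 1 - μ ^ 2 := by ring
      rw [← norm_mul, e, ← norm_pow]
      simpa only [norm_one] using norm_sub_norm_le (1 : ℂ) (μ ^ 2)
    rcases le_total ‖μ‖ 1 with h | h
    · linarith
    · nlinarith [mul_nonneg (norm_nonneg (1 - μ)) (norm_nonneg (1 + μ))]
  have h22 : √2 * √2 = 2 := Real.mul_self_sqrt (by norm_num)
  have hpos : 0 < √(1 + ‖1 - μ‖ * ‖1 + μ‖ + ‖μ‖ ^ 2) := Real.sqrt_pos.2 (by positivity)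
  rw [one_sub_norm_optRoot_sq, div_le_iff₀ (by positivity)]
  set N := ‖1 + Complex.sqrt (1 - μ ^ 2)‖
  set T := √(1 + ‖1 - μ‖ * ‖1 + μ‖ + ‖μ‖ ^ 2)
  calc 4 * (Complex.sqrt (1 - μ ^ 2)).re ≤ 4 * (√‖1 - μ‖ * √‖1 + μ‖ * M) := by linarith
    _ ≤ 4 * (√‖1 - μ‖ * (1 * T) * M) := by rw [one_mul]; gcongr
    _ ≤ 4 * (√‖1 - μ‖ * (N * T) * M) := by gcongr
    _ = 2 * (√2 * √2) * M * √‖1 - μ‖ * (N * T) := by rw [h22]; ring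
    _ = _ := by ring

theorem le_one_sub_norm_optRoot_sq (hre : 0 ≤ μ.re) {R : ℝ} (hR : ‖μ - 1‖ ≤ R) {m : ℝ}
    (hm₀ : 0 ≤ m) (hm : √‖1 - μ‖ * √‖1 + μ‖ * m ≤ (Complex.sqrt (1 - μ ^ 2)).re) :
    2 * √2 * cStar R * m * √‖1 - μ‖ ≤ 1 - ‖optRoot μ‖ ^ 2 := by
  rw [norm_sub_rev] at hR
  have hc : cStar R ≤ cStar ‖1 - μ‖ :=
    cStar_strictAntiOn.antitoneOn (norm_nonneg (1 - μ)) ((norm_nonneg _).trans hR) hR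
  set r := ‖1 - μ‖ with hr
  have hr0 : 0 ≤ r := norm_nonneg _
  set a := ‖1 + μ‖ with ha
  have hra : r ^ 2 + a ^ 2 = 2 + 2 * ‖μ‖ ^ 2 := by
    rw [hr, ha, norm_one_add_sq, norm_one_sub_sq]; ring
  have hle : r ≤ a := by
    rw [← sq_le_sq₀ (norm_nonneg _) (norm_nonneg _), norm_one_add_sq, norm_one_sub_sq]
    linarith
  have ha1 : 1 ≤ a := by
    have h := Complex.re_le_norm (1 + μ)
    simp only [Complex.add_re, Complex.one_re] at h
    linarith
  have ha2 : 2 - r ≤ a := by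
    have h := norm_add_le (1 - μ) (1 + μ)
    rw [show (1 - μ) + (1 + μ) = 2 by ring, Complex.norm_ofNat] at h
    linarith
  have ha3 : a ≤ 2 + r := by
    have h := norm_sub_le (2 : ℂ) (1 - μ)
    rw [show (2 : ℂ) - (1 - μ) = 1 + μ by ring, Complex.norm_ofNat] at h
    linarith
  have hgeo := sqrt_add_div_sqrt_mul_cConst_le hr0 hle ha1 ha2 ha3
  set N := ‖1 + Complex.sqrt (1 - μ ^ 2)‖ with hN
  have hN0 : 0 < N := norm_pos_iff.2 (one_add_sqrt_ne_zero _)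
  have hNle : N ≤ 1 + √(r * (2 + r)) := by
    have h : N ≤ 1 + ‖Complex.sqrt (1 - μ ^ 2)‖ := (norm_add_le _ _).trans (by rw [norm_one])
    have h' : ‖Complex.sqrt (1 - μ ^ 2)‖ ≤ √(r * (2 + r)) := by
      apply Real.le_sqrt_of_sq_le
      rw [← norm_pow, sq, Complex.sqrt_mul_self_eq, show 1 - μ ^ 2 = (1 - μ) * (1 + μ) by ring,
        norm_mul]
      gcongr
    linarith
  -- By the parallelogram identity `hra`, the same quantity is also `|1 + μ| + |1 - μ|`, which
  -- `hgeo` controls.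
  have hT : √2 * √(1 + r * a + ‖μ‖ ^ 2) = a + r := by
    rw [← Real.sqrt_mul (by norm_num), Real.sqrt_eq_iff_mul_self_eq (by positivity) (by positivity)]
    nlinarith
  have hcc : cStar r * N ≤ cConst r := by
    rw [cStar, div_mul_eq_mul_div, div_le_iff₀ (by positivity)]
    have := cConst_pos r
    gcongr
  have h22 : √2 * √2 = 2 := Real.mul_self_sqrt (by norm_num)
  have har : 0 < a + r := by linarith
  rw [one_sub_norm_optRoot_sq, hT, le_div_iff₀ (by positivity)]
  calc 2 * √2 * cStar R * m * √r * (N * (a + r))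
      ≤ 2 * √2 * cStar r * m * √r * (N * (a + r)) := by gcongr
    _ = 2 * √2 * m * √r * (a + r) * (cStar r * N) := by ring
    _ ≤ 2 * √2 * m * √r * (a + r) * cConst r := by gcongr
    _ = 2 * √2 * m * √r * ((a + r) * cConst r) := by ring
    _ ≤ 2 * √2 * m * √r * (√2 * √a) := by gcongr
    _ = 2 * (√2 * √2) * (√r * √a * m) := by ring
    _ = 4 * (√r * √a * m) := by rw [h22]; ring
    _ ≤ 4 * (Complex.sqrt (1 - μ ^ 2)).re := by linarith

end

theorem theorem2p3 {n : ℕ} (A : Matrix (Fin n) (Fin n) ℂ)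
    (hA : IsConsistentlyOrderedTwoCyclic A) (μ : ℂ) (hre : 0 ≤ μ.re)
    (hseg : spectrum ℂ (jacobi A) ⊆ symSegment μ)
    (hpos : μ ∈ spectrum ℂ (jacobi A)) (hneg : -μ ∈ spectrum ℂ (jacobi A)) :
    -- the optimal relaxation parameter, unique off the slit
    IsOptimalRelaxation A (omegaOpt μ) ∧
    (μ ∉ slit → ∀ ω : ℂ, IsOptimalRelaxation A ω → ω = omegaOpt μ) ∧
    -- the optimal spectral radius
    specRad (sor A (omegaOpt μ)) = ‖1 - omegaOpt μ‖ ∧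
    -- the constants in the bounds
    ((∀ R : ℝ, 0 ≤ R → 0 < cStar R) ∧ StrictAntiOn cStar (Set.Ici 0) ∧ cStar 0 = 1) ∧
    (∃ β ∈ Set.Icc 0 (Real.arctan |μ.im| / 2),
      IsMinOn (fun β : ℝ => Real.sin (|Complex.arg (μ - 1)| / 2 + β))
        (Set.Icc 0 (Real.arctan |μ.im| / 2)) β) ∧
    (∃ β ∈ Set.Icc 0 (Real.arctan |μ.im| / 2),
      IsMaxOn (fun β : ℝ => Real.sin (|Complex.arg (μ - 1)| / 2 + β))
        (Set.Icc 0 (Real.arctan |μ.im| / 2)) β) ∧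
    -- the lower bound
    (∀ R : ℝ, ‖μ - 1‖ ≤ R → ∀ βm ∈ Set.Icc 0 (Real.arctan |μ.im| / 2),
      IsMinOn (fun β : ℝ => Real.sin (|Complex.arg (μ - 1)| / 2 + β))
        (Set.Icc 0 (Real.arctan |μ.im| / 2)) βm →
      2 * √2 * cStar R * Real.sin (|Complex.arg (μ - 1)| / 2 + βm) * √‖1 - μ‖ ≤
        1 - specRad (sor A (omegaOpt μ))) ∧
    -- the upper bound
    (∀ βM ∈ Set.Icc 0 (Real.arctan |μ.im| / 2),
      IsMaxOn (fun β : ℝ => Real.sin (|Complex.arg (μ - 1)| / 2 + β))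
        (Set.Icc 0 (Real.arctan |μ.im| / 2)) βM →
      1 - specRad (sor A (omegaOpt μ)) ≤
        2 * √2 * Real.sin (|Complex.arg (μ - 1)| / 2 + βM) * √‖1 - μ‖) ∧
    -- convergence off the slit, and the slit
    (μ ∉ slit → specRad (sor A (omegaOpt μ)) < 1) ∧
    (μ ∈ slit → specRad (sor A (omegaOpt μ)) = 1) := by
  have hρ := specRad_sor_omegaOpt hA hre hseg hpos
  -- The true angle in `re_sqrt_one_sub_sq` is thus one admissible `β`, to be compared with the
  -- minimizer and the maximizer.
  have hmem : |(1 + μ).arg| / 2 ∈ Set.Icc 0 (Real.arctan |μ.im| / 2) :=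
    ⟨by positivity, by linarith [Complex.abs_arg_one_add_le hre]⟩
  have hsin : ∀ β ∈ Set.Icc 0 (Real.arctan |μ.im| / 2),
      0 ≤ Real.sin (|Complex.arg (μ - 1)| / 2 + β) := by
    intro β hβ
    have h1 := Complex.abs_arg_le_pi (μ - 1)
    have h2 := Real.arctan_lt_pi_div_two |μ.im|
    exact Real.sin_nonneg_of_nonneg_of_le_pi (add_nonneg (by positivity) hβ.1)
      (by linarith [hβ.2, Real.pi_pos])
  have hcont : ContinuousOn (fun β : ℝ => Real.sin (|Complex.arg (μ - 1)| / 2 + β))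
      (Set.Icc 0 (Real.arctan |μ.im| / 2)) := by fun_prop
  refine ⟨?_, ?_, ?_, ⟨fun R _ => cStar_pos R, cStar_strictAntiOn, cStar_zero⟩,
    isCompact_Icc.exists_isMinOn ⟨_, hmem⟩ hcont, isCompact_Icc.exists_isMaxOn ⟨_, hmem⟩ hcont,
    ?_, ?_, ?_, ?_⟩
  · intro ω
    rw [hρ]
    exact norm_optRoot_sq_le_specRad_sor hA hre hpos ω
  · intro hμ ω hω
    exact eq_omegaOpt_of_specRad_le hA hre hpos hμ ((hω _).trans_eq hρ)
  · rw [hρ, norm_one_sub_omegaOpt]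
  · intro R hR β hβ hmin
    rw [hρ]
    refine le_one_sub_norm_optRoot_sq hre hR (hsin β hβ) ?_
    rw [re_sqrt_one_sub_sq hre]
    exact mul_le_mul_of_nonneg_left (hmin hmem) (by positivity)
  · intro β hβ hmax
    rw [hρ]
    refine one_sub_norm_optRoot_sq_le (hsin β hβ) ?_
    rw [re_sqrt_one_sub_sq hre]
    exact mul_le_mul_of_nonneg_left (hmax hmem) (by positivity)
  · intro hμ
    rw [hρ]
    exact pow_lt_one₀ (norm_nonneg _) (norm_optRoot_lt_one hre hμ) two_ne_zero
  · intro hμ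
    rw [hρ, norm_optRoot_eq_one hμ, one_pow]
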